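/- For $n\in\mathbb N$ let $N=2^n$ and let $S\subseteq\{0,1\}^n$ be a non-empty set of $M=|S|$ marked strings $x_1,\dots,x_M$ with Hamming weights $n_1,\dots,n_M$. Let $|\psi_0\rangle=N^{-1/2}\sum_{x\in\{0,1\}^n}|x\rangle$ and $|S_1\rangle=M^{-1/2}\sum_{i=1}^M|x_i\rangle$, let $O$ be the oracle $O|x\rangle=-|x\rangle$ for $x\in S$, $O|x\rangle=|x\rangle$ for $x\notin S$, let $G=(2|\psi_0\rangle\langle\psi_0|-I)\,O$ be the Grover iteration, and let $|\psi_{k,M}\rangle=G^k|\psi_0\rangle$. Put $\theta=\arcsin\sqrt{M/N}$, $\theta_k=(2k+1)\theta$, let $k_{opt}$ be the integer closest to $\frac12\left(\frac{\pi}{2\theta}-1\right)$ (the larger one in case of a tie), and define the turning point $$\theta_{k_T}=\arctan\left(\frac{\sqrt M}{\max_{\alpha\in[0,\pi]}\sum_{i=1}^M\cos^{n-n_i}\frac{\alpha}{2}\,\sin^{n_i}\frac{\alpha}{2}}\right).$$ For an $n$-qubit state $|\psi\rangle$ let $E(|\psi\rangle)=1-\max_{\phi}|\langle\psi|\phi\rangle|^2$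 be its geometric measure of entanglement, where the maximum is over all products $|\phi\rangle=\bigotimes_{s=1}^n|\phi_s\rangle$ of single-qubit pure states. Theorem. When $N\gg M$ and $|S_1\rangle$ is symmetric (invariant under all permutations of the $n$ qubits), then for $0\le k\le k_{opt}$ $$E(|\psi_{k,M}\rangle)\simeq\begin{cases}\sin^2\theta_k, & \theta_k\le\theta_{k_T},\\[2pt] 1-\dfrac{\sin^2\theta_k}{M}\,\max_{\alpha\in[0,\pi]}\left|\sum_{i=1}^M\cos^{n-n_i}\frac{\alpha}{2}\,\sin^{n_i}\frac{\alpha}{2}\right|^2, & \theta_k>\theta_{k_T},\end{cases}$$ in the following sense: for every $\varepsilon>0$ there is $\delta>0$ such that for all $n$, all non-empty $S\subseteq\{0,1\}^n$ with $M\le\delta N$ and $|S_1\rangle$ symmetric, and all $0\le k\le k_{opt}$, the two sides differ by at most $\varepsilon$ in absolute value. -/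

import Mathlib

noncomputable section

namespace GroverGME

/-- The Hilbert space of one qubit, with orthonormal basis `|0⟩, |1⟩`. -/
abbrev Qubit : Type := EuclideanSpace ℂ (Fin 2)

/-- The Hilbert space of `n` qubits, with orthonormal basis `|x⟩`, `x ∈ {0,1}^n`. -/
abbrev QState (n : ℕ) : Type := EuclideanSpace ℂ (Fin n → Fin 2)

/-- The computational basis state `|x⟩`. -/
def ket {n : ℕ} (x : Fin n → Fin 2) : QState n := EuclideanSpace.single x 1

/-- The product (fully separable) vector `φ₁ ⊗ ⋯ ⊗ φₙ`. -/
def productState {n : ℕ} (φ : Fin n → Qubit) : QState n :=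
  WithLp.toLp 2 fun x => ∏ s, φ s (x s)

/-- The squared overlaps `|⟨ψ|φ⟩|²` of `ψ` with all products `φ` of single-qubit pure states. -/
def sepOverlaps {n : ℕ} (ψ : QState n) : Set ℝ :=
  (fun φ : Fin n → Qubit => ‖inner ℂ ψ (productState φ)‖ ^ 2) '' {φ | ∀ s, ‖φ s‖ = 1}

/-- Geometric measure of entanglement `E(ψ) = 1 - max_φ |⟨ψ|φ⟩|²`. -/
def gme {n : ℕ} (ψ : QState n) : ℝ := 1 - sSup (sepOverlaps ψ)

/-- The supremum in the definition of `gme` is a maximum. -/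
theorem isGreatest_sepOverlaps {n : ℕ} (ψ : QState n) :
    IsGreatest (sepOverlaps ψ) (sSup (sepOverlaps ψ)) := by
  have hK : {φ : Fin n → Qubit | ∀ s, ‖φ s‖ = 1}
      = Set.pi Set.univ fun _ => Metric.sphere (0 : Qubit) 1 := by
    ext φ; simp
  have hc : IsCompact {φ : Fin n → Qubit | ∀ s, ‖φ s‖ = 1} := by
    rw [hK]; exact isCompact_univ_pi fun _ => isCompact_sphere _ _
  have hne : ({φ : Fin n → Qubit | ∀ s, ‖φ s‖ = 1}).Nonempty :=
    ⟨fun _ => EuclideanSpace.single 0 1, fun s => by simp⟩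
  have hcont : Continuous
      (fun φ : Fin n → Qubit => ‖inner ℂ ψ (productState φ)‖ ^ 2) := by
    unfold productState
    fun_prop
  exact (hc.image hcont).isGreatest_sSup (hne.image _)

/-- The operation on `n`-qubit states that permutes the qubits by `σ`. -/
def permuteQubits {n : ℕ} (σ : Equiv.Perm (Fin n)) (v : QState n) : QState n :=
  WithLp.toLp 2 fun x => v (x ∘ σ)

/-- A state is symmetric if every qubit permutation fixes it. -/
def IsSymmetricState {n : ℕ} (v : QState n) : Prop :=
  ∀ σ : Equiv.Perm (Fin n), permuteQubits σ v = v

/-- The uniform superposition `|ψ₀⟩ = N^{-1/2} ∑_x |x⟩`, `N = 2^n`. -/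
def uniformState (n : ℕ) : QState n :=
  ((1 / Real.sqrt ((2 : ℝ) ^ n) : ℝ) : ℂ) • ∑ x : Fin n → Fin 2, ket x

/-- The superposition `|S₁⟩ = M^{-1/2} ∑_{x ∈ S} |x⟩` of the marked states, `M = |S|`. -/
def markedState {n : ℕ} (S : Finset (Fin n → Fin 2)) : QState n :=
  ((1 / Real.sqrt (S.card : ℝ) : ℝ) : ℂ) • ∑ x ∈ S, ket x

/-- The oracle `|x⟩ ↦ (-1)^{[x ∈ S]} |x⟩`. -/
def oracle {n : ℕ} (S : Finset (Fin n → Fin 2)) (v : QState n) : QState n :=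
  WithLp.toLp 2 fun x => if x ∈ S then -(v x) else v x

/-- The inversion about the mean `2|ψ₀⟩⟨ψ₀| - I`. -/
def diffusion {n : ℕ} (v : QState n) : QState n :=
  (2 * inner ℂ (uniformState n) v) • uniformState n - v

/-- The Grover iteration `G = (2|ψ₀⟩⟨ψ₀| - I) O`. -/
def grover {n : ℕ} (S : Finset (Fin n → Fin 2)) (v : QState n) : QState n :=
  diffusion (oracle S v)

/-- The state `G^k |ψ₀⟩` after `k` Grover iterations. -/
def groverState {n : ℕ} (S : Finset (Fin n → Fin 2)) (k : ℕ) : QState n :=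
  (grover S)^[k] (uniformState n)

/-- The angle `θ = arcsin √(M/N)`. -/
def theta {n : ℕ} (S : Finset (Fin n → Fin 2)) : ℝ :=
  Real.arcsin (Real.sqrt ((S.card : ℝ) / 2 ^ n))

/-- The angle `θ_k = (2k+1)θ`. -/
def thetaIter {n : ℕ} (S : Finset (Fin n → Fin 2)) (k : ℕ) : ℝ :=
  (2 * (k : ℝ) + 1) * theta S

/-- The optimal number of iterations: the integer closest to `(π/(2θ) - 1)/2`. -/
def optIter {n : ℕ} (S : Finset (Fin n → Fin 2)) : ℕ :=
  (round ((Real.pi / (2 * theta S) - 1) / 2)).toNat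

/-- `∑_i cos^{n-n_i}(α/2) sin^{n_i}(α/2)` over the marked states, `n_i` being the Hamming weight
(number of ones) of the `i`-th one. -/
def weightSum {n : ℕ} (S : Finset (Fin n → Fin 2)) (α : ℝ) : ℝ :=
  ∑ x ∈ S, Real.cos (α / 2) ^ (n - hammingNorm x) * Real.sin (α / 2) ^ hammingNorm x

/-- `max_{α ∈ [0,π]} ∑_i cos^{n-n_i}(α/2) sin^{n_i}(α/2)`. -/
def maxWeightSum {n : ℕ} (S : Finset (Fin n → Fin 2)) : ℝ :=
  sSup ((fun α => weightSum S α) '' Set.Icc 0 Real.pi)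

/-- `max_{α ∈ [0,π]} |∑_i cos^{n-n_i}(α/2) sin^{n_i}(α/2)|²`. -/
def maxWeightSumSq {n : ℕ} (S : Finset (Fin n → Fin 2)) : ℝ :=
  sSup ((fun α => |weightSum S α| ^ 2) '' Set.Icc 0 Real.pi)

theorem continuous_weightSum {n : ℕ} (S : Finset (Fin n → Fin 2)) :
    Continuous (weightSum S) := by
  unfold weightSum
  fun_prop

/-- The supremum in `maxWeightSum` is a maximum. -/
theorem isGreatest_maxWeightSum {n : ℕ} (S : Finset (Fin n → Fin 2)) :
    IsGreatest ((fun α => weightSum S α) '' Set.Icc 0 Real.pi) (maxWeightSum S) :=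
  (isCompact_Icc.image (continuous_weightSum S)).isGreatest_sSup
    ((Set.nonempty_Icc.2 Real.pi_pos.le).image _)

/-- The supremum in `maxWeightSumSq` is a maximum. -/
theorem isGreatest_maxWeightSumSq {n : ℕ} (S : Finset (Fin n → Fin 2)) :
    IsGreatest ((fun α => |weightSum S α| ^ 2) '' Set.Icc 0 Real.pi) (maxWeightSumSq S) :=
  (isCompact_Icc.image ((continuous_weightSum S).abs.pow 2)).isGreatest_sSup
    ((Set.nonempty_Icc.2 Real.pi_pos.le).image _)

/-- The turning point `θ_{k_T} = arctan (√M / max_α ∑_i cos^{n-n_i}(α/2) sin^{n_i}(α/2))`. -/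
def turningPoint {n : ℕ} (S : Finset (Fin n → Fin 2)) : ℝ :=
  Real.arctan (Real.sqrt (S.card : ℝ) / maxWeightSum S)

end GroverGME

end

/-! The state after k iterations is sin θ_k |S₁⟩ + cos θ_k |S₁^⊥⟩, where |S₁^⊥⟩ is the uniform
superposition of the unmarked strings (`groverState_eq`). Its overlap with a product state is
therefore at most sin θ_k · X + |cos θ_k| · Z, where X and Z are the overlaps of |S₁⟩ and |S₁^⊥⟩
with the product of the amplitude moduli.

When M ≪ N, X and Z cannot both be non-negligible: a product with large overlap on the uniform state
is spread out and puts little weight on few strings. Quantitatively, X⁴u⁸ ≤ M/N, where u is the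
overlap with |ψ₀⟩ (`angleSum_trade_off`, `small_overlap_or`). So the maximal overlap is, up to a
small error, max(A sin θ_k, |cos θ_k|) with A = max X. The second value is nearly reached by
|+⟩^{⊗n}, the first by an optimal product for |S₁⟩.

For symmetric |S₁⟩ with non-negative amplitudes, replacing two angles by their mean never lowers X.
The optimum is thus a power of one real qubit, and A = max_α(∑…)/√M (`angleSum_le_maxWeightSum`).
The turning point is exactly where A sin θ = cos θ. -/

namespace GroverGME

/-! ### Real product states and the symmetric optimum -/

/-- The amplitude of the real qubit state `cos a |0⟩ + sin a |1⟩` at `b`. -/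
noncomputable def realAmp (a : ℝ) (b : Fin 2) : ℝ := if b = 0 then Real.cos a else Real.sin a

theorem realAmp_nonneg {a : ℝ} (ha : a ∈ Set.Icc 0 (Real.pi / 2)) (b : Fin 2) :
    0 ≤ realAmp a b := by
  unfold realAmp
  split_ifs
  · exact Real.cos_nonneg_of_mem_Icc ⟨by linarith [ha.1, Real.pi_pos], ha.2⟩
  · exact Real.sin_nonneg_of_nonneg_of_le_pi ha.1 (by linarith [ha.2, Real.pi_pos])

theorem continuous_realAmp (b : Fin 2) : Continuous fun a => realAmp a b := by
  unfold realAmp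
  split_ifs <;> fun_prop

/-- With m the mean and d the half-difference, cos a cos b = cos² m - sin² d and sin a sin b = sin²
m - sin² d, while the mixed terms sum to sin 2m, with equality. -/
theorem realAmp_midpoint (a b : ℝ) (p q : Fin 2) :
    realAmp a p * realAmp b q + realAmp b p * realAmp a q
      ≤ 2 * (realAmp ((a + b) / 2) p * realAmp ((a + b) / 2) q) := by
  have ea : a = (a + b) / 2 + (a - b) / 2 := by ring
  have eb : b = (a + b) / 2 - (a - b) / 2 := by ring
  generalize (a + b) / 2 = m at *
  generalize (a - b) / 2 = d at *
  subst ea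
  rw [eb]
  have h1 := Real.sin_sq_add_cos_sq m
  have h2 := Real.sin_sq_add_cos_sq d
  unfold realAmp
  split_ifs <;> simp only [Real.cos_add, Real.cos_sub, Real.sin_add, Real.sin_sub]
  · nlinarith [sq_nonneg (Real.sin d), sq_nonneg (Real.cos d)]
  · exact le_of_eq (by linear_combination 2 * Real.cos m * Real.sin m * h2)
  · exact le_of_eq (by linear_combination 2 * Real.cos m * Real.sin m * h2)
  · nlinarith [sq_nonneg (Real.sin d), sq_nonneg (Real.cos d)]

/-- The unnormalised overlap of a product of real qubit states with the marked states. -/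
noncomputable def angleSum {n : ℕ} (S : Finset (Fin n → Fin 2)) (a : Fin n → ℝ) : ℝ :=
  ∑ x ∈ S, ∏ s, realAmp (a s) (x s)

theorem continuous_angleSum {n : ℕ} (S : Finset (Fin n → Fin 2)) : Continuous (angleSum S) := by
  unfold angleSum
  exact continuous_finsetSum _ fun x _ => continuous_finsetProd _ fun s _ =>
    (continuous_realAmp (x s)).comp (continuous_apply s)

theorem angleSum_const {n : ℕ} (S : Finset (Fin n → Fin 2)) (c : ℝ) :
    angleSum S (fun _ => c) = weightSum S (2 * c) := by
  unfold angleSum weightSum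
  refine Finset.sum_congr rfl fun x _ => ?_
  have h2 : 2 * c / 2 = c := by ring
  simp only [h2, realAmp, Finset.prod_ite, Finset.prod_const]
  have h := Finset.card_filter_add_card_filter_not (s := (Finset.univ : Finset (Fin n)))
    (fun i => x i = 0)
  rw [Finset.card_univ, Fintype.card_fin] at h
  have hn : hammingNorm x = (Finset.univ.filter fun i => ¬ x i = 0).card := rfl
  rw [hn]
  congr 2
  omega

/-- The amplitude at a string is a non-zero constant on S and zero elsewhere, so it detects
membership. -/
theorem mem_comp_perm_iff {n : ℕ} {S : Finset (Fin n → Fin 2)} (hS : S.Nonempty)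
    (hsym : IsSymmetricState (markedState S)) (σ : Equiv.Perm (Fin n)) (x : Fin n → Fin 2) :
    x ∘ σ ∈ S ↔ x ∈ S := by
  have hM : (0 : ℝ) < S.card := by exact_mod_cast hS.card_pos
  have hval (y : Fin n → Fin 2) : (markedState S) y
      = if y ∈ S then ((1 / Real.sqrt (S.card : ℝ) : ℝ) : ℂ) else 0 := by
    simp [markedState, ket, Finset.sum_apply, Pi.single_apply]
  have h0 : ((1 / Real.sqrt (S.card : ℝ) : ℝ) : ℂ) ≠ 0 :=
    Complex.ofReal_ne_zero.2 (by positivity)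
  have h : (markedState S) (x ∘ σ) = (markedState S) x :=
    congrArg (fun v : QState n => v x) (hsym σ)
  rw [hval, hval] at h
  generalize ((1 / Real.sqrt (S.card : ℝ) : ℝ) : ℂ) = z at h h0
  by_cases h1 : x ∘ σ ∈ S <;> by_cases h2 : x ∈ S <;> simp [h1, h2] at h ⊢
  exacts [h0 h, h0 h.symm]

theorem angleSum_comp_perm {n : ℕ} {S : Finset (Fin n → Fin 2)}
    (hS : ∀ (σ : Equiv.Perm (Fin n)) x, x ∘ σ ∈ S ↔ x ∈ S) (a : Fin n → ℝ)
    (σ : Equiv.Perm (Fin n)) : angleSum S (a ∘ σ) = angleSum S a := by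
  unfold angleSum
  refine Finset.sum_bij' (fun x _ => x ∘ σ.symm) (fun x _ => x ∘ σ)
    (fun x hx => (hS _ _).2 hx) (fun x hx => (hS _ _).2 hx)
    (fun x _ => by ext; simp) (fun x _ => by ext; simp) fun x _ => ?_
  exact Fintype.prod_equiv σ _ _ fun s => by simp

/-- Averaging two angles does not decrease the overlap. -/
theorem angleSum_le_average {n : ℕ} {S : Finset (Fin n → Fin 2)}
    (hS : ∀ (σ : Equiv.Perm (Fin n)) x, x ∘ σ ∈ S ↔ x ∈ S) {a : Fin n → ℝ}
    (ha : ∀ s, a s ∈ Set.Icc 0 (Real.pi / 2)) {i j : Fin n} (hij : i ≠ j) :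
    angleSum S a ≤ angleSum S
      (Function.update (Function.update a i ((a i + a j) / 2)) j ((a i + a j) / 2)) := by
  set b := Function.update (Function.update a i ((a i + a j) / 2)) j ((a i + a j) / 2) with hb
  have hsplit (f : Fin n → ℝ) : ∏ s, f s = f i * f j * ∏ s ∈ {i, j}ᶜ, f s := by
    rw [← Finset.prod_mul_prod_compl {i, j} f, Finset.prod_pair hij]
  -- Adding the swapped angles symmetrises each term in qubits i and j, so the midpoint inequality
  -- applies string by string; by invariance of S both sums on the left are equal.
  have hmain : angleSum S a + angleSum S (a ∘ Equiv.swap i j) ≤ 2 * angleSum S b := by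
    unfold angleSum
    rw [← Finset.sum_add_distrib, Finset.mul_sum]
    refine Finset.sum_le_sum fun x _ => ?_
    rw [hsplit, hsplit fun s => realAmp ((a ∘ Equiv.swap i j) s) (x s),
      hsplit fun s => realAmp (b s) (x s)]
    have hne {s : Fin n} (hs : s ∈ ({i, j} : Finset (Fin n))ᶜ) : s ≠ i ∧ s ≠ j := by
      simpa using hs
    have e1 : ∏ s ∈ {i, j}ᶜ, realAmp ((a ∘ Equiv.swap i j) s) (x s)
        = ∏ s ∈ {i, j}ᶜ, realAmp (a s) (x s) := Finset.prod_congr rfl fun s hs => by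
      rw [Function.comp, Equiv.swap_apply_of_ne_of_ne (hne hs).1 (hne hs).2]
    have e2 : ∏ s ∈ {i, j}ᶜ, realAmp (b s) (x s)
        = ∏ s ∈ {i, j}ᶜ, realAmp (a s) (x s) := Finset.prod_congr rfl fun s hs => by
      rw [hb, Function.update_of_ne (hne hs).2, Function.update_of_ne (hne hs).1]
    have e3 : b i = (a i + a j) / 2 := by
      rw [hb, Function.update_of_ne hij, Function.update_self]
    have e4 : b j = (a i + a j) / 2 := by rw [hb, Function.update_self]
    rw [e1, e2, e3, e4]
    simp only [Function.comp, Equiv.swap_apply_left, Equiv.swap_apply_right]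
    have h := mul_le_mul_of_nonneg_right (realAmp_midpoint (a i) (a j) (x i) (x j))
      (Finset.prod_nonneg fun s (_ : s ∈ ({i, j} : Finset (Fin n))ᶜ) =>
        realAmp_nonneg (ha s) (x s))
    linarith
  rw [angleSum_comp_perm hS] at hmain
  linarith

/-- For a permutation-invariant set the best real product state is a power. -/
theorem angleSum_le_maxWeightSum {n : ℕ} {S : Finset (Fin n → Fin 2)}
    (hS : ∀ (σ : Equiv.Perm (Fin n)) x, x ∘ σ ∈ S ↔ x ∈ S) {a : Fin n → ℝ}
    (ha : ∀ s, a s ∈ Set.Icc 0 (Real.pi / 2)) :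
    angleSum S a ≤ maxWeightSum S := by
  have hK : IsCompact ((Set.univ.pi fun _ : Fin n => Set.Icc 0 (Real.pi / 2))
      ∩ {b | angleSum S a ≤ angleSum S b}) :=
    (isCompact_univ_pi fun _ => isCompact_Icc).inter_right
      (isClosed_le continuous_const (continuous_angleSum S))
  -- Among all angle vectors at least as good as a, take one with least sum of squares. Averaging
  -- two unequal entries would stay in this set and strictly lower that sum, so all entries agree.
  obtain ⟨b, ⟨hbI, hbS⟩, hmin⟩ := hK.exists_isMinOn ⟨a, fun s _ => ha s, le_refl (angleSum S a)⟩
    (f := fun b : Fin n → ℝ => ∑ s, b s ^ 2) (by fun_prop)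
  replace hbI : ∀ s, b s ∈ Set.Icc 0 (Real.pi / 2) := fun s => hbI s trivial
  have hconst : ∀ i j, b i = b j := by
    intro i j
    by_contra hne
    have hij : i ≠ j := fun h => hne (by rw [h])
    set c := Function.update (Function.update b i ((b i + b j) / 2)) j ((b i + b j) / 2) with hc
    have hcI : c ∈ Set.univ.pi fun _ : Fin n => Set.Icc 0 (Real.pi / 2) := by
      intro s _
      have hm : (b i + b j) / 2 ∈ Set.Icc 0 (Real.pi / 2) :=
        ⟨by linarith [(hbI i).1, (hbI j).1], by linarith [(hbI i).2, (hbI j).2]⟩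
      simp only [hc, Function.update_apply]
      split_ifs
      exacts [hm, hm, hbI s]
    have hle : ∑ s, b s ^ 2 ≤ ∑ s, c s ^ 2 :=
      hmin ⟨hcI, le_trans hbS (angleSum_le_average hS hbI hij)⟩
    rw [← Finset.sum_add_sum_compl {i, j} fun s => b s ^ 2,
      ← Finset.sum_add_sum_compl {i, j} fun s => c s ^ 2, Finset.sum_pair hij,
      Finset.sum_pair hij] at hle
    have e : ∑ s ∈ {i, j}ᶜ, c s ^ 2 = ∑ s ∈ {i, j}ᶜ, b s ^ 2 :=
      Finset.sum_congr rfl fun s hs => by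
        have hs' : s ≠ i ∧ s ≠ j := by simpa using hs
        rw [hc, Function.update_of_ne hs'.2, Function.update_of_ne hs'.1]
    have e3 : c i = (b i + b j) / 2 := by
      rw [hc, Function.update_of_ne hij, Function.update_self]
    have e4 : c j = (b i + b j) / 2 := by rw [hc, Function.update_self]
    rw [e, e3, e4] at hle
    have : 0 < (b i - b j) ^ 2 := by have := sub_ne_zero.2 hne; positivity
    nlinarith
  obtain ⟨c, hcI, hbc⟩ : ∃ c ∈ Set.Icc 0 (Real.pi / 2), b = fun _ => c := by
    rcases n with _ | n
    · exact ⟨0, ⟨le_rfl, by positivity⟩, funext fun s => s.elim0⟩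
    · exact ⟨b 0, hbI 0, funext fun s => hconst s 0⟩
  refine le_trans hbS ?_
  rw [hbc, angleSum_const]
  exact (isGreatest_maxWeightSum S).2
    ⟨2 * c, ⟨by linarith [hcI.1], by linarith [hcI.2]⟩, rfl⟩

/-- The moduli of the amplitudes of a single-qubit pure state come from an angle. -/
theorem exists_realAmp_eq_norm {v : Qubit} (hv : ‖v‖ = 1) :
    ∃ a ∈ Set.Icc 0 (Real.pi / 2), ∀ b, ‖v b‖ = realAmp a b := by
  have h : ‖v 0‖ ^ 2 + ‖v 1‖ ^ 2 = 1 := by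
    have := EuclideanSpace.norm_sq_eq v
    rw [hv, Fin.sum_univ_two] at this
    linarith
  refine ⟨Real.arccos ‖v 0‖, ⟨Real.arccos_nonneg _, Real.arccos_le_pi_div_two.2 (norm_nonneg _)⟩,
    fun b => ?_⟩
  have h1 : ‖v 0‖ ≤ 1 := by nlinarith [norm_nonneg (v 0), sq_nonneg ‖v 1‖]
  fin_cases b
  · simp [realAmp, Real.cos_arccos (by linarith [norm_nonneg (v 0)]) h1]
  · have : 1 - ‖v 0‖ ^ 2 = ‖v 1‖ ^ 2 := by linarith
    simp [realAmp, Real.sin_arccos, this]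

/-! ### Trade-off between overlaps with |ψ₀⟩ and with few basis states -/

theorem realAmp_sq_sum (a : ℝ) : ∑ b, realAmp a b ^ 2 = 1 := by
  simp [Fin.sum_univ_two, realAmp]

/-- A qubit state close to `|+⟩` is spread out over the computational basis. -/
theorem quartic_trade_off (a : ℝ) :
    (∑ b, realAmp a b ^ 4) * (∑ b, realAmp a b) ^ 8 ≤ 8 := by
  have h := realAmp_sq_sum a
  simp only [Fin.sum_univ_two] at *
  generalize realAmp a 0 = p at *
  generalize realAmp a 1 = q at *
  have e1 : p ^ 4 + q ^ 4 = 1 - 2 * (p * q) ^ 2 := by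
    linear_combination (p ^ 2 + q ^ 2 + 1) * h
  have e2 : (p + q) ^ 2 = 1 + 2 * (p * q) := by linear_combination h
  have e3 : (p + q) ^ 8 = (1 + 2 * (p * q)) ^ 4 := by rw [← e2]; ring
  have h1 : 2 * (p * q) ≤ 1 := by nlinarith [sq_nonneg (p - q)]
  have h2 : 0 ≤ 1 + 2 * (p * q) := by nlinarith [sq_nonneg (p + q)]
  rw [e1, e3]
  -- Here v measures the distance from |+⟩, where v = 0 and equality holds. The left side becomes
  -- 8(1 + 2v - v²)(1 - v/2)⁴. With fourth powers in the first factor, 8 is the least exponent of p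
  -- + q for which |+⟩ is the maximiser.
  obtain ⟨v, hv⟩ : ∃ v, p * q = (1 - v) / 2 := ⟨1 - 2 * (p * q), by ring⟩
  rw [hv] at h1 h2 ⊢
  have hv0 : 0 ≤ v := by linarith
  have hv2 : v ≤ 2 := by linarith
  have hb : 1 + 2 * v - v ^ 2 ≤ (1 + v / 2) ^ 4 := by nlinarith [pow_nonneg hv0 3, pow_nonneg hv0 4]
  have hs : (1 - v ^ 2 / 4) ^ 4 ≤ 1 :=
    pow_le_one₀ (by nlinarith) (by nlinarith)
  have hm := mul_le_mul_of_nonneg_left hb (by positivity : 0 ≤ (1 - v / 2) ^ 4)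
  have : (1 - v / 2) ^ 4 * (1 + v / 2) ^ 4 = (1 - v ^ 2 / 4) ^ 4 := by ring
  nlinarith

theorem sum_univ_prod_realAmp_pow {n : ℕ} (a : Fin n → ℝ) (m : ℕ) :
    ∑ x : Fin n → Fin 2, (∏ s, realAmp (a s) (x s)) ^ m = ∏ s, ∑ b, realAmp (a s) b ^ m := by
  simp only [← Finset.prod_pow]
  exact (Fintype.prod_sum fun s b => realAmp (a s) b ^ m).symm

/-- A product state cannot overlap strongly both with the uniform superposition and with the
superposition of a small set of basis states. -/
theorem angleSum_trade_off {n : ℕ} (S : Finset (Fin n → Fin 2)) {a : Fin n → ℝ}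
    (ha : ∀ s, a s ∈ Set.Icc 0 (Real.pi / 2)) :
    angleSum S a ^ 4 * angleSum Finset.univ a ^ 8 ≤ (S.card : ℝ) ^ 3 * 8 ^ n := by
  have hnn (x : Fin n → Fin 2) : 0 ≤ ∏ s, realAmp (a s) (x s) :=
    Finset.prod_nonneg fun s _ => realAmp_nonneg (ha s) _
  -- Power mean inequality on S; the sum of fourth powers is then extended to all strings so that it
  -- factorises over the qubits.
  have h1 : angleSum S a ^ 4 ≤ (S.card : ℝ) ^ 3 * ∏ s, ∑ b, realAmp (a s) b ^ 4 := by
    rw [← sum_univ_prod_realAmp_pow]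
    have h := pow_sum_div_card_le_sum_pow (s := S) (fun x _ => hnn x) 3
    rcases S.eq_empty_or_nonempty with rfl | hS
    · simp [angleSum]
    have hM : (0 : ℝ) < S.card := by exact_mod_cast hS.card_pos
    rw [div_le_iff₀ (by positivity), mul_comm] at h
    refine h.trans (mul_le_mul_of_nonneg_left ?_ (by positivity))
    exact Finset.sum_le_univ_sum_of_nonneg fun x => pow_nonneg (hnn x) _
  have h2 : angleSum Finset.univ a = ∏ s, ∑ b, realAmp (a s) b := by
    simpa only [pow_one, angleSum] using sum_univ_prod_realAmp_pow a 1
  calc angleSum S a ^ 4 * angleSum Finset.univ a ^ 8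
      ≤ ((S.card : ℝ) ^ 3 * ∏ s, ∑ b, realAmp (a s) b ^ 4) * angleSum Finset.univ a ^ 8 :=
        mul_le_mul_of_nonneg_right h1 (by positivity)
    _ = (S.card : ℝ) ^ 3 * ∏ s, (∑ b, realAmp (a s) b ^ 4) * (∑ b, realAmp (a s) b) ^ 8 := by
        rw [h2, Finset.prod_mul_distrib, Finset.prod_pow, mul_assoc]
    _ ≤ (S.card : ℝ) ^ 3 * ∏ _s : Fin n, (8 : ℝ) := by
        gcongr with s
        exact quartic_trade_off _
    _ = (S.card : ℝ) ^ 3 * 8 ^ n := by simp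

theorem angleSum_nonneg {n : ℕ} (S : Finset (Fin n → Fin 2)) {a : Fin n → ℝ}
    (ha : ∀ s, a s ∈ Set.Icc 0 (Real.pi / 2)) : 0 ≤ angleSum S a :=
  Finset.sum_nonneg fun _ _ => Finset.prod_nonneg fun s _ => realAmp_nonneg (ha s) _

/-- Cauchy–Schwarz, since the product vector has norm one. -/
theorem angleSum_le_sqrt_card {n : ℕ} (S : Finset (Fin n → Fin 2)) (a : Fin n → ℝ) :
    angleSum S a ≤ √(S.card : ℝ) := by
  refine Real.le_sqrt_of_sq_le (sq_sum_le_card_mul_sum_sq.trans ?_)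
  have h : ∑ x ∈ S, (∏ s, realAmp (a s) (x s)) ^ 2 ≤ 1 := by
    refine (Finset.sum_le_univ_sum_of_nonneg fun _ => sq_nonneg _).trans_eq ?_
    rw [sum_univ_prod_realAmp_pow]
    exact Finset.prod_eq_one fun s _ => realAmp_sq_sum _
  exact mul_le_of_le_one_right (by positivity) h

theorem angleSum_pi_div_four {n : ℕ} (S : Finset (Fin n → Fin 2)) :
    angleSum S (fun _ => Real.pi / 4) = S.card / √(2 ^ n) := by
  have h (b : Fin 2) : realAmp (Real.pi / 4) b = (√2)⁻¹ := by
    have : √2 / 2 = (√2)⁻¹ := by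
      rw [div_eq_iff two_ne_zero, inv_mul_eq_div, Real.div_sqrt]
    simp [realAmp, this]
  have h2 : √((2 : ℝ) ^ n) = √2 ^ n := by
    rw [Real.sqrt_eq_iff_mul_self_eq (by positivity) (by positivity), ← mul_pow,
      Real.mul_self_sqrt zero_le_two]
  rw [div_eq_mul_inv _ √_]
  simp only [angleSum, h, h2, Finset.prod_const, Finset.sum_const, Finset.card_univ,
    Fintype.card_fin, nsmul_eq_mul, inv_pow]

/-! ### The Grover iteration as a plane rotation -/

theorem sin_theta {n : ℕ} (S : Finset (Fin n → Fin 2)) :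
    Real.sin (theta S) = √((S.card : ℝ) / 2 ^ n) := by
  have h : (S.card : ℝ) ≤ 2 ^ n := by
    have := S.card_le_univ
    simp only [Fintype.card_pi, Fintype.card_fin, Finset.prod_const, Finset.card_univ] at this
    exact_mod_cast this
  refine Real.sin_arcsin (by linarith [Real.sqrt_nonneg ((S.card : ℝ) / 2 ^ n)]) ?_
  exact Real.sqrt_le_one.2 ((div_le_one (by positivity)).2 h)

theorem sqrt_card_eq {n : ℕ} (S : Finset (Fin n → Fin 2)) :
    √(S.card : ℝ) = √(2 ^ n) * Real.sin (theta S) := by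
  rw [sin_theta, ← Real.sqrt_mul (by positivity), mul_div_cancel₀ _ (by positivity)]

theorem cos_theta_nonneg {n : ℕ} (S : Finset (Fin n → Fin 2)) : 0 ≤ Real.cos (theta S) := by
  rw [theta, Real.cos_arcsin]
  positivity

theorem sqrt_card_compl_eq {n : ℕ} (S : Finset (Fin n → Fin 2)) :
    √(Sᶜ.card : ℝ) = √(2 ^ n) * Real.cos (theta S) := by
  have hc : (Sᶜ.card : ℝ) = 2 ^ n - S.card := by
    rw [eq_sub_iff_add_eq]
    have := S.card_compl_add_card
    simp only [Fintype.card_pi, Fintype.card_fin, Finset.prod_const, Finset.card_univ] at this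
    exact_mod_cast this
  have h := congrArg (· ^ 2) (sqrt_card_eq S)
  simp only [mul_pow, Real.sq_sqrt (show (0 : ℝ) ≤ 2 ^ n by positivity),
    Real.sq_sqrt (Nat.cast_nonneg' (α := ℝ) S.card)] at h
  rw [Real.sqrt_eq_iff_mul_self_eq (by positivity)
    (mul_nonneg (Real.sqrt_nonneg _) (cos_theta_nonneg S)), hc, h]
  have := Real.mul_self_sqrt (show (0 : ℝ) ≤ 2 ^ n by positivity)
  linear_combination -this * Real.cos (theta S) ^ 2
    - (2 : ℝ) ^ n * Real.sin_sq_add_cos_sq (theta S)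

/-- The state with amplitude `p / √M` on `S` and `q / √(N - M)` off `S`. -/
noncomputable def twoLevelState {n : ℕ} (S : Finset (Fin n → Fin 2)) (p q : ℝ) : QState n :=
  WithLp.toLp 2 fun x => if x ∈ S then ((p / √(S.card : ℝ) : ℝ) : ℂ)
    else ((q / √(Sᶜ.card : ℝ) : ℝ) : ℂ)

theorem uniformState_apply {n : ℕ} (x : Fin n → Fin 2) :
    uniformState n x = ((1 / √(2 ^ n) : ℝ) : ℂ) := by
  simp [uniformState, ket, Finset.sum_apply, Pi.single_apply]

theorem inner_uniformState {n : ℕ} (v : QState n) :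
    inner ℂ (uniformState n) v = ((1 / √(2 ^ n) : ℝ) : ℂ) * ∑ x, v x := by
  rw [PiLp.inner_apply, Finset.mul_sum]
  refine Finset.sum_congr rfl fun x _ => ?_
  rw [uniformState_apply, RCLike.inner_apply, Complex.conj_ofReal, mul_comm]

theorem sum_ite_mem_const {n : ℕ} (S : Finset (Fin n → Fin 2)) (p q : ℂ) :
    ∑ x, (if x ∈ S then p else q) = S.card * p + Sᶜ.card * q := by
  rw [Finset.sum_ite]
  simp [Finset.filter_not, Finset.compl_eq_univ_sdiff]

theorem card_mul_div_sqrt (m : ℕ) (p : ℝ) : (m : ℝ) * (p / √(m : ℝ)) = √(m : ℝ) * p := by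
  rw [mul_div_left_comm, Real.div_sqrt, mul_comm]

/-- Two reflections of the plane compose to a rotation by 2θ: the oracle sends the angle t to -t,
and reflection about |ψ₀⟩, which sits at angle θ, sends -t to 2θ + t. -/
theorem grover_twoLevelState {n : ℕ} {S : Finset (Fin n → Fin 2)} (hS : S.Nonempty)
    (hS' : Sᶜ.Nonempty) (t : ℝ) :
    grover S (twoLevelState S (Real.sin t) (Real.cos t))
      = twoLevelState S (Real.sin (t + 2 * theta S)) (Real.cos (t + 2 * theta S)) := by
  have hM : 0 < √(S.card : ℝ) := Real.sqrt_pos.2 (by exact_mod_cast hS.card_pos)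
  have hM' : 0 < √(Sᶜ.card : ℝ) := Real.sqrt_pos.2 (by exact_mod_cast hS'.card_pos)
  have hN : 0 < √((2 : ℝ) ^ n) := by positivity
  have e1 := sqrt_card_eq S
  have e2 := sqrt_card_compl_eq S
  have hu (x : Fin n → Fin 2) := uniformState_apply x
  have hi (v : QState n) := inner_uniformState v
  generalize √((2 : ℝ) ^ n) = r at hN e1 e2 hu hi
  have horacle (x : Fin n → Fin 2) : oracle S (twoLevelState S (Real.sin t) (Real.cos t)) x
      = if x ∈ S then ((-(Real.sin t / √(S.card : ℝ)) : ℝ) : ℂ)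
        else ((Real.cos t / √(Sᶜ.card : ℝ) : ℝ) : ℂ) := by
    by_cases hx : x ∈ S <;> simp [oracle, twoLevelState, hx]
  have hinner : inner ℂ (uniformState n) (oracle S (twoLevelState S (Real.sin t) (Real.cos t)))
      = ((Real.cos (t + theta S) : ℝ) : ℂ) := by
    rw [hi, Finset.sum_congr rfl fun x _ => horacle x, sum_ite_mem_const]
    norm_cast
    rw [mul_neg, card_mul_div_sqrt, card_mul_div_sqrt, e1, e2, Real.cos_add]
    field_simp
    ring
  have h2 : (2 : ℂ) * ((Real.cos (t + theta S) : ℝ) : ℂ)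
      = ((2 * Real.cos (t + theta S) : ℝ) : ℂ) := by push_cast; rfl
  have es : Real.sin t = Real.sin ((t + theta S) - theta S) := by rw [add_sub_cancel_right]
  have ec : Real.cos t = Real.cos ((t + theta S) - theta S) := by rw [add_sub_cancel_right]
  have et2 : t + 2 * theta S = (t + theta S) + theta S := by ring
  ext x
  rw [grover, diffusion, hinner, h2]
  simp only [PiLp.sub_apply, PiLp.smul_apply, smul_eq_mul, hu, horacle]
  simp only [twoLevelState]
  split_ifs
  · norm_cast
    rw [e1] at hM ⊢
    have : Real.sin (theta S) ≠ 0 := right_ne_zero_of_mul hM.ne'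
    rw [et2, Real.sin_add (t + theta S), es, Real.sin_sub]
    field_simp
    ring
  · norm_cast
    rw [e2] at hM' ⊢
    have : Real.cos (theta S) ≠ 0 := right_ne_zero_of_mul hM'.ne'
    rw [et2, Real.cos_add (t + theta S) (theta S), ec, Real.cos_sub]
    field_simp
    ring

theorem groverState_eq {n : ℕ} {S : Finset (Fin n → Fin 2)} (hS : S.Nonempty)
    (hS' : Sᶜ.Nonempty) (k : ℕ) :
    groverState S k
      = twoLevelState S (Real.sin (thetaIter S k)) (Real.cos (thetaIter S k)) := by
  induction k with
  | zero =>
    have hM : 0 < √(S.card : ℝ) := Real.sqrt_pos.2 (by exact_mod_cast hS.card_pos)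
    have hM' : 0 < √(Sᶜ.card : ℝ) := Real.sqrt_pos.2 (by exact_mod_cast hS'.card_pos)
    have hN : 0 < √((2 : ℝ) ^ n) := by positivity
    have ht : thetaIter S 0 = theta S := by simp [thetaIter]
    ext x
    rw [groverState, Function.iterate_zero_apply, uniformState_apply, ht, twoLevelState]
    rw [sqrt_card_eq S] at hM ⊢
    rw [sqrt_card_compl_eq S] at hM' ⊢
    have h1 : Real.sin (theta S) ≠ 0 := right_ne_zero_of_mul hM.ne'
    have h2 : Real.cos (theta S) ≠ 0 := right_ne_zero_of_mul hM'.ne'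
    simp only
    split_ifs <;> congr 1 <;> field_simp
  | succ k ih =>
    have ht : thetaIter S (k + 1) = thetaIter S k + 2 * theta S := by
      simp only [thetaIter]
      push_cast
      ring
    rw [ht, ← grover_twoLevelState hS hS', ← ih, groverState, groverState,
      Function.iterate_succ_apply']

/-! ### Overlaps of two-level states with products -/

theorem inner_twoLevelState {n : ℕ} (S : Finset (Fin n → Fin 2)) (p q : ℝ) (v : QState n) :
    inner ℂ (twoLevelState S p q) v = ((p / √(S.card : ℝ) : ℝ) : ℂ) * ∑ x ∈ S, v x
      + ((q / √(Sᶜ.card : ℝ) : ℝ) : ℂ) * ∑ x ∈ Sᶜ, v x := by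
  rw [PiLp.inner_apply, ← Finset.sum_add_sum_compl S, Finset.mul_sum, Finset.mul_sum]
  congr 1 <;> refine Finset.sum_congr rfl fun x hx => ?_
  · simp only [twoLevelState, hx, if_true, RCLike.inner_apply, Complex.conj_ofReal, mul_comm]
  · simp only [twoLevelState, Finset.mem_compl.1 hx, if_false, RCLike.inner_apply,
      Complex.conj_ofReal, mul_comm]

/-- The triangle inequality discards all phases. The same angles serve S and its complement, which
lets the trade-off act on the two terms jointly. -/
theorem exists_norm_inner_twoLevelState_le {n : ℕ} (S : Finset (Fin n → Fin 2)) (p q : ℝ)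
    {φ : Fin n → Qubit} (hφ : ∀ s, ‖φ s‖ = 1) :
    ∃ a : Fin n → ℝ, (∀ s, a s ∈ Set.Icc 0 (Real.pi / 2)) ∧
      ‖inner ℂ (twoLevelState S p q) (productState φ)‖
        ≤ |p| * (angleSum S a / √(S.card : ℝ)) + |q| * (angleSum Sᶜ a / √(Sᶜ.card : ℝ)) := by
  choose a ha hn using fun s => exists_realAmp_eq_norm (hφ s)
  refine ⟨a, ha, ?_⟩
  have hsum (T : Finset (Fin n → Fin 2)) :
      ‖∑ x ∈ T, productState φ x‖ ≤ angleSum T a := by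
    refine (norm_sum_le _ _).trans_eq (Finset.sum_congr rfl fun x _ => ?_)
    simp [productState, norm_prod, hn]
  have hterm (r : ℝ) (T : Finset (Fin n → Fin 2)) :
      ‖((r / √(T.card : ℝ) : ℝ) : ℂ) * ∑ x ∈ T, productState φ x‖
        ≤ |r| * (angleSum T a / √(T.card : ℝ)) := by
    rw [norm_mul, Complex.norm_real, Real.norm_eq_abs, abs_div,
      abs_of_nonneg (Real.sqrt_nonneg _), mul_div_left_comm, mul_comm]
    exact mul_le_mul_of_nonneg_right (hsum T) (by positivity)
  rw [inner_twoLevelState]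
  exact (norm_add_le _ _).trans (add_le_add (hterm p S) (hterm q Sᶜ))

/-- The test state is the n-th power of cos c |0⟩ + sin c |1⟩; the signs of p and q are kept. -/
theorem sq_le_sSup_sepOverlaps {n : ℕ} (S : Finset (Fin n → Fin 2)) (p q : ℝ) (c : ℝ) :
    (p * (angleSum S (fun _ => c) / √(S.card : ℝ))
      + q * (angleSum Sᶜ (fun _ => c) / √(Sᶜ.card : ℝ))) ^ 2
      ≤ sSup (sepOverlaps (twoLevelState S p q)) := by
  refine (isGreatest_sepOverlaps _).2
    ⟨fun _ => WithLp.toLp 2 fun b => ((realAmp c b : ℝ) : ℂ), fun _ => ?_, ?_⟩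
  · rw [EuclideanSpace.norm_eq, Real.sqrt_eq_one]
    simp only [Complex.norm_real, Real.norm_eq_abs, sq_abs]
    exact realAmp_sq_sum c
  · have hsum (T : Finset (Fin n → Fin 2)) :
        ∑ x ∈ T, productState (fun _ => WithLp.toLp 2 fun b => ((realAmp c b : ℝ) : ℂ)) x
          = ((angleSum T (fun _ => c) : ℝ) : ℂ) := by
      simp [productState, angleSum]
    simp only [inner_twoLevelState, hsum]
    norm_cast
    rw [Real.norm_eq_abs, sq_abs]
    ring

/-! ### The maximal weight sum and the range of θ_k -/

theorem weightSum_nonneg {n : ℕ} (S : Finset (Fin n → Fin 2)) {α : ℝ}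
    (hα : α ∈ Set.Icc 0 Real.pi) : 0 ≤ weightSum S α := by
  have h := angleSum_nonneg S (a := fun _ => α / 2)
    fun _ => ⟨by linarith [hα.1], by linarith [hα.2]⟩
  rwa [angleSum_const, mul_div_cancel₀ _ two_ne_zero] at h

theorem exists_angleSum_eq_maxWeightSum {n : ℕ} (S : Finset (Fin n → Fin 2)) :
    ∃ c ∈ Set.Icc 0 (Real.pi / 2), angleSum S (fun _ => c) = maxWeightSum S := by
  obtain ⟨α, hα, h⟩ := (isGreatest_maxWeightSum S).1
  refine ⟨α / 2, ⟨by linarith [hα.1], by linarith [hα.2]⟩, ?_⟩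
  rw [angleSum_const, mul_div_cancel₀ _ two_ne_zero]
  exact h

theorem maxWeightSum_pos {n : ℕ} {S : Finset (Fin n → Fin 2)} (hS : S.Nonempty) :
    0 < maxWeightSum S := by
  have hM : (0 : ℝ) < S.card := by exact_mod_cast hS.card_pos
  have h : 0 < weightSum S (2 * (Real.pi / 4)) := by
    rw [← angleSum_const, angleSum_pi_div_four]
    positivity
  exact h.trans_le ((isGreatest_maxWeightSum S).2
    ⟨_, ⟨by positivity, by linarith [Real.pi_pos]⟩, rfl⟩)

theorem maxWeightSumSq_eq {n : ℕ} (S : Finset (Fin n → Fin 2)) :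
    maxWeightSumSq S = maxWeightSum S ^ 2 := by
  obtain ⟨α, hα, h⟩ := (isGreatest_maxWeightSum S).1
  refine (isGreatest_maxWeightSumSq S).unique ⟨⟨α, hα, ?_⟩, ?_⟩
  · simp only [sq_abs] at h ⊢
    rw [h]
  · rintro _ ⟨β, hβ, rfl⟩
    have h0 := weightSum_nonneg S hβ
    have h1 : weightSum S β ≤ maxWeightSum S := (isGreatest_maxWeightSum S).2 ⟨β, hβ, rfl⟩
    simp only [sq_abs]
    gcongr

theorem theta_pos {n : ℕ} {S : Finset (Fin n → Fin 2)} (hS : S.Nonempty) : 0 < theta S := by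
  have hM : (0 : ℝ) < S.card := by exact_mod_cast hS.card_pos
  exact Real.arcsin_pos.2 (by positivity)

/-- Rounding moves the real optimum, where (2y + 1)θ = π/2, by at most 1/2, so θ_k overshoots π/2 by
at most θ. -/
theorem thetaIter_le {n : ℕ} {S : Finset (Fin n → Fin 2)} (hS : S.Nonempty) {k : ℕ}
    (hk : k ≤ optIter S) : thetaIter S k ≤ Real.pi / 2 + theta S := by
  have hθ := theta_pos hS
  have hθ' : theta S ≤ Real.pi / 2 := Real.arcsin_le_pi_div_two _
  set y := (Real.pi / (2 * theta S) - 1) / 2 with hy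
  have hmul : (2 * y + 1) * theta S = Real.pi / 2 := by
    rw [hy]
    field_simp
    ring
  have hy0 : 0 ≤ y := by
    have : 1 ≤ Real.pi / (2 * theta S) := (one_le_div (by positivity)).2 (by linarith)
    rw [hy]
    linarith
  have hr : (0 : ℤ) ≤ round y := by
    rw [round_eq]
    exact Int.floor_nonneg.2 (by linarith)
  have hk' : (k : ℤ) ≤ round y := by
    rw [← Int.toNat_of_nonneg hr]
    exact_mod_cast hk
  have hk2 : (k : ℝ) ≤ round y := by exact_mod_cast hk'
  have h := (abs_le.1 (abs_sub_round y)).1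
  have : (k : ℝ) ≤ y + 1 / 2 := by linarith
  unfold thetaIter
  nlinarith

/-! ### Error estimates on the two sides of the turning point -/

theorem small_overlap_or {n : ℕ} {S : Finset (Fin n → Fin 2)} (hS : S.Nonempty) {η : ℝ}
    (hη : 0 < η) (hη' : η ≤ 1) (hM : (S.card : ℝ) ≤ η ^ 12 / 256 * 2 ^ n) {a : Fin n → ℝ}
    (ha : ∀ s, a s ∈ Set.Icc 0 (Real.pi / 2)) :
    angleSum S a / √(S.card : ℝ) ≤ η ∨ angleSum Sᶜ a / √(Sᶜ.card : ℝ) ≤ η := by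
  by_contra! h
  obtain ⟨h1, h2⟩ := h
  have hm0 : (0 : ℝ) < S.card := by exact_mod_cast hS.card_pos
  have hN0 : (0 : ℝ) < 2 ^ n := by positivity
  have hη12 : η ^ 12 ≤ 1 := pow_le_one₀ hη.le hη'
  have hc : (Sᶜ.card : ℝ) + S.card = 2 ^ n := by
    have := S.card_compl_add_card
    simp only [Fintype.card_pi, Fintype.card_fin, Finset.prod_const, Finset.card_univ] at this
    exact_mod_cast this
  -- At least half of all strings are unmarked, so passing from N to N - M costs a factor 2⁴ = 16.
  -- If both overlaps exceeded η, the trade-off would give M/N > η⁴η⁸/16.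
  have hc2 : (2 : ℝ) ^ n ≤ 2 * Sᶜ.card := by nlinarith
  have hc0 : (0 : ℝ) < Sᶜ.card := by linarith
  have h8 : (8 : ℝ) ^ n = (2 ^ n) ^ 3 := by rw [← pow_mul, mul_comm, pow_mul]; norm_num
  have hU : angleSum Sᶜ a ≤ angleSum Finset.univ a :=
    Finset.sum_le_univ_sum_of_nonneg fun x =>
      Finset.prod_nonneg fun s _ => realAmp_nonneg (ha s) _
  have hX := angleSum_nonneg S ha
  have hZ := angleSum_nonneg Sᶜ ha
  rw [lt_div_iff₀ (by positivity)] at h1 h2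
  have h4 : (η * √(S.card : ℝ)) ^ 4 = η ^ 4 * (S.card : ℝ) ^ 2 := by
    rw [mul_pow, show 4 = 2 * 2 from rfl, pow_mul (√_), Real.sq_sqrt hm0.le]
  have h8' : (η * √(Sᶜ.card : ℝ)) ^ 8 = η ^ 8 * (Sᶜ.card : ℝ) ^ 4 := by
    rw [mul_pow, show 8 = 2 * 4 from rfl, pow_mul (√_), Real.sq_sqrt hc0.le]
  have hlt : η ^ 4 * (S.card : ℝ) ^ 2 * (η ^ 8 * (Sᶜ.card : ℝ) ^ 4)
      < (S.card : ℝ) ^ 3 * (2 ^ n) ^ 3 := by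
    rw [← h4, ← h8', ← h8]
    refine lt_of_lt_of_le ?_ (angleSum_trade_off S ha)
    refine mul_lt_mul'' ?_ ?_ (by positivity) (by positivity)
    · exact pow_lt_pow_left₀ h1 (by positivity) (by norm_num)
    · exact pow_lt_pow_left₀ (h2.trans_le hU) (by positivity) (by norm_num)
  have hc4 : ((2 : ℝ) ^ n) ^ 4 ≤ 16 * (Sᶜ.card : ℝ) ^ 4 := by
    calc ((2 : ℝ) ^ n) ^ 4 ≤ (2 * (Sᶜ.card : ℝ)) ^ 4 := by gcongr
      _ = _ := by ring
  have : (S.card : ℝ) ^ 3 * (2 ^ n) ^ 3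
      ≤ η ^ 4 * (S.card : ℝ) ^ 2 * (η ^ 8 * (Sᶜ.card : ℝ) ^ 4) := by
    calc (S.card : ℝ) ^ 3 * (2 ^ n) ^ 3
        = (S.card : ℝ) * ((S.card : ℝ) ^ 2 * (2 ^ n) ^ 3) := by ring
      _ ≤ η ^ 12 / 256 * 2 ^ n * ((S.card : ℝ) ^ 2 * (2 ^ n) ^ 3) := by gcongr
      _ = η ^ 12 / 256 * (S.card : ℝ) ^ 2 * (2 ^ n) ^ 4 := by ring
      _ ≤ η ^ 12 / 16 * (S.card : ℝ) ^ 2 * (Sᶜ.card : ℝ) ^ 4 := by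
          have : 0 ≤ η ^ 12 / 256 * (S.card : ℝ) ^ 2 := by positivity
          nlinarith
      _ ≤ η ^ 12 * (S.card : ℝ) ^ 2 * (Sᶜ.card : ℝ) ^ 4 := by
          gcongr
          linarith [pow_pos hη 12]
      _ = _ := by ring
  linarith

/-- For use past the turning point: u = A sin θ_k, B = max(u, |cos θ_k|), Q is the maximal squared
overlap and r the overlap of an explicit test state. -/
theorem abs_one_sub_sub_le {η u B Q r : ℝ} (hη : 0 < η) (hη' : η ≤ 1) (hu0 : 0 ≤ u) (hu1 : u ≤ 1)
    (hB0 : 0 ≤ B) (hB1 : B ≤ 1) (hB : B ≤ u + η) (hQ : Q ≤ (B + η) ^ 2) (hr : u - η ≤ r)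
    (hQ' : r ^ 2 ≤ Q) : |1 - Q - (1 - u ^ 2)| ≤ 6 * η := by
  rw [abs_le]
  constructor
  · have h1 : (B + η) ^ 2 ≤ B ^ 2 + 3 * η := by nlinarith
    have h2 : B ^ 2 ≤ u ^ 2 + 3 * η := by nlinarith
    linarith
  · rcases le_total u η with h | h
    · have : 0 ≤ Q := (sq_nonneg _).trans hQ'
      nlinarith
    · have : (u - η) ^ 2 ≤ Q :=
        (pow_le_pow_left₀ (by linarith) hr 2).trans hQ'
      nlinarith

/-- For use before the turning point: (s, c) and (x, y) are sine and cosine of θ_k and θ. The test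
state loses only c²x² ≤ η against c². -/
theorem abs_one_sub_sub_sq_le {η s c x y Q : ℝ} (hη : 0 < η) (hη' : η ≤ 1)
    (hsc : s ^ 2 + c ^ 2 = 1) (hs : 0 ≤ s) (hc : 0 ≤ c) (hxy : x ^ 2 + y ^ 2 = 1) (hx : 0 ≤ x)
    (hy : 0 ≤ y) (hxη : x ^ 2 ≤ η) (hQ : Q ≤ (c + η) ^ 2) (hQ' : (s * x + c * y) ^ 2 ≤ Q) :
    |1 - Q - s ^ 2| ≤ 6 * η := by
  have hc1 : c ≤ 1 := by nlinarith
  have hlow : (c * y) ^ 2 ≤ (s * x + c * y) ^ 2 :=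
    pow_le_pow_left₀ (by positivity) (by linarith [mul_nonneg hs hx]) 2
  have hcx : c ^ 2 * x ^ 2 ≤ x ^ 2 := mul_le_of_le_one_left (sq_nonneg _) (by nlinarith)
  rw [abs_le]
  constructor
  · nlinarith
  · have : (c * y) ^ 2 = c ^ 2 - c ^ 2 * x ^ 2 := by
      rw [mul_pow, eq_sub_of_add_eq' hxy]
      ring
    linarith

theorem gme_groverState_bounds {n : ℕ} {S : Finset (Fin n → Fin 2)} (hS : S.Nonempty) {η : ℝ}
    (hη : 0 < η) (hη' : η ≤ 1) (hM : (S.card : ℝ) ≤ η ^ 12 / 256 * 2 ^ n)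
    (hsym : IsSymmetricState (markedState S)) {k : ℕ} (hk : k ≤ optIter S) :
    (thetaIter S k ≤ turningPoint S →
      |gme (groverState S k) - Real.sin (thetaIter S k) ^ 2| ≤ 6 * η) ∧
    (turningPoint S < thetaIter S k →
      |gme (groverState S k)
        - (1 - Real.sin (thetaIter S k) ^ 2 / (S.card : ℝ) * maxWeightSumSq S)| ≤ 6 * η) := by
  have hm0 : (0 : ℝ) < S.card := by exact_mod_cast hS.card_pos
  have hsm : 0 < √(S.card : ℝ) := Real.sqrt_pos.2 hm0
  have hN0 : (0 : ℝ) < 2 ^ n := by positivity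
  have hη2 : η ^ 12 ≤ η ^ 2 := pow_le_pow_of_le_one hη.le hη' (by norm_num)
  have hη21 : η ^ 2 ≤ η := by nlinarith
  have hθ := theta_pos hS
  have hθ' : theta S ≤ Real.pi / 2 := Real.arcsin_le_pi_div_two _
  have hsinθ : 0 ≤ Real.sin (theta S) := by rw [sin_theta]; positivity
  have hsinθ2 : Real.sin (theta S) ^ 2 ≤ η ^ 2 / 256 := by
    rw [sin_theta, Real.sq_sqrt (by positivity), div_le_iff₀ hN0]
    refine hM.trans ?_
    gcongr
  have hsinη : Real.sin (theta S) ≤ η := (sq_le_sq₀ hsinθ hη.le).1 (by linarith [sq_nonneg η])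
  have hcosθ := cos_theta_nonneg S
  have hpyθ := Real.sin_sq_add_cos_sq (theta S)
  have hS' : Sᶜ.Nonempty := by
    rw [← Finset.card_pos]
    have h : 0 < √(Sᶜ.card : ℝ) := by
      rw [sqrt_card_compl_eq]
      have : 0 < Real.cos (theta S) := by
        refine lt_of_le_of_ne hcosθ fun h => ?_
        rw [← h] at hpyθ
        nlinarith
      positivity
    exact_mod_cast Real.sqrt_pos.1 h
  have hsm' : 0 < √(Sᶜ.card : ℝ) := Real.sqrt_pos.2 (by exact_mod_cast hS'.card_pos)
  have hperm := mem_comp_perm_iff hS hsym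
  set t := thetaIter S k with ht
  have ht0 : 0 < t := by rw [ht, thetaIter]; positivity
  have htle : t ≤ Real.pi / 2 + theta S := thetaIter_le hS hk
  have hs0 : 0 ≤ Real.sin t := Real.sin_nonneg_of_nonneg_of_le_pi ht0.le (by linarith)
  have hs1 := Real.sin_le_one t
  have hpy := Real.sin_sq_add_cos_sq t
  have hc1 := Real.abs_cos_le_one t
  set A := maxWeightSum S / √(S.card : ℝ) with hA
  have hW := maxWeightSum_pos hS
  have hA0 : 0 < A := by positivity
  obtain ⟨c, hc, hcW⟩ := exists_angleSum_eq_maxWeightSum S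
  have hA1 : A ≤ 1 := by
    rw [hA, div_le_one hsm, ← hcW]
    exact angleSum_le_sqrt_card _ _
  have hstate := groverState_eq hS hS' k
  rw [← ht] at hstate
  have hupper : sSup (sepOverlaps (groverState S k))
      ≤ (max (Real.sin t * A) |Real.cos t| + η) ^ 2 := by
    obtain ⟨φ, hφ, h⟩ := (isGreatest_sepOverlaps (groverState S k)).1
    rw [← h]
    obtain ⟨a, ha, hle⟩ :=
      exists_norm_inner_twoLevelState_le S (Real.sin t) (Real.cos t) hφ
    simp only [hstate]
    refine pow_le_pow_left₀ (norm_nonneg _) (hle.trans ?_) 2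
    rw [abs_of_nonneg hs0]
    have hX0 : 0 ≤ angleSum S a / √(S.card : ℝ) := div_nonneg (angleSum_nonneg S ha) hsm.le
    have hZ0 : 0 ≤ angleSum Sᶜ a / √(Sᶜ.card : ℝ) := div_nonneg (angleSum_nonneg Sᶜ ha) hsm'.le
    have hXA : angleSum S a / √(S.card : ℝ) ≤ A :=
      div_le_div_of_nonneg_right (angleSum_le_maxWeightSum hperm ha) hsm.le
    have hZ1 : angleSum Sᶜ a / √(Sᶜ.card : ℝ) ≤ 1 :=
      (div_le_one hsm').2 (angleSum_le_sqrt_card _ _)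
    rcases small_overlap_or hS hη hη' hM ha with h | h
    · have h1 : Real.sin t * (angleSum S a / √(S.card : ℝ)) ≤ η :=
        (mul_le_of_le_one_left hX0 hs1).trans h
      have h2 := mul_le_of_le_one_right (abs_nonneg (Real.cos t)) hZ1
      linarith [le_max_right (Real.sin t * A) |Real.cos t|]
    · have h1 : |Real.cos t| * (angleSum Sᶜ a / √(Sᶜ.card : ℝ)) ≤ η :=
        (mul_le_of_le_one_left hZ0 hc1).trans h
      have h2 := mul_le_mul_of_nonneg_left hXA hs0
      linarith [le_max_left (Real.sin t * A) |Real.cos t|]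
  have hsA0 : 0 ≤ Real.sin t * A := by positivity
  have hsA1 : Real.sin t * A ≤ 1 := mul_le_one₀ hs1 hA0.le hA1
  constructor
  · intro hT
    have htan : t < Real.pi / 2 := hT.trans_lt (Real.arctan_lt_pi_div_two _)
    have hct : 0 < Real.cos t := Real.cos_pos_of_mem_Ioo ⟨by linarith, htan⟩
    have hle : Real.sin t * A ≤ Real.cos t := by
      have h1 : Real.tan t ≤ √(S.card : ℝ) / maxWeightSum S := by
        rw [← Real.tan_arctan (√(S.card : ℝ) / maxWeightSum S)]
        exact Real.strictMonoOn_tan.monotoneOn ⟨by linarith, htan⟩ (Real.arctan_mem_Ioo _) hT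
      rw [Real.tan_eq_sin_div_cos, div_le_div_iff₀ hct hW] at h1
      rw [hA, ← mul_div_assoc, div_le_iff₀ hsm]
      linarith
    rw [abs_of_pos hct, max_eq_right hle] at hupper
    -- The angle π/4 gives |+⟩^{⊗n} = |ψ₀⟩, whose overlaps with |S₁⟩ and |S₁^⊥⟩ are sin θ and cos θ.
    have hlower := sq_le_sSup_sepOverlaps S (Real.sin t) (Real.cos t) (Real.pi / 4)
    rw [← hstate, angleSum_pi_div_four, angleSum_pi_div_four, div_right_comm, Real.div_sqrt,
      div_right_comm, Real.div_sqrt, sqrt_card_eq, sqrt_card_compl_eq,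
      mul_div_cancel_left₀ _ (by positivity), mul_div_cancel_left₀ _ (by positivity)] at hlower
    exact abs_one_sub_sub_sq_le hη hη' hpy hs0 hct.le hpyθ hsinθ hcosθ (by linarith) hupper hlower
  · intro hT
    have hle : |Real.cos t| ≤ Real.sin t * A + η ∧ -η ≤ Real.cos t := by
      rcases lt_or_ge t (Real.pi / 2) with htan | htan
      · have hct : 0 < Real.cos t := Real.cos_pos_of_mem_Ioo ⟨by linarith, htan⟩
        have h1 : √(S.card : ℝ) / maxWeightSum S < Real.tan t := by
          rw [← Real.tan_arctan (√(S.card : ℝ) / maxWeightSum S)]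
          exact Real.strictMonoOn_tan (Real.arctan_mem_Ioo _) ⟨by linarith, htan⟩ hT
        rw [Real.tan_eq_sin_div_cos, div_lt_div_iff₀ hW hct] at h1
        have : Real.cos t ≤ Real.sin t * A := by
          rw [hA, ← mul_div_assoc, le_div_iff₀ hsm]
          linarith
        rw [abs_of_pos hct]
        constructor <;> linarith
      · have h1 : -Real.cos t ≤ Real.sin (theta S) := by
          rw [← Real.sin_sub_pi_div_two]
          exact Real.sin_le_sin_of_le_of_le_pi_div_two (by linarith [Real.pi_pos]) hθ'
            (by linarith)
        have h2 : Real.cos t ≤ 0 :=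
          Real.cos_nonpos_of_pi_div_two_le_of_le htan (by linarith)
        rw [abs_of_nonpos h2]
        constructor <;> linarith
    have hmax : max (Real.sin t * A) |Real.cos t| ≤ Real.sin t * A + η :=
      max_le (by linarith) hle.1
    have hmax1 : max (Real.sin t * A) |Real.cos t| ≤ 1 := max_le hsA1 hc1
    have hmax0 : 0 ≤ max (Real.sin t * A) |Real.cos t| := le_max_of_le_left hsA0
    have hlower := sq_le_sSup_sepOverlaps S (Real.sin t) (Real.cos t) c
    rw [← hstate, hcW, ← hA] at hlower
    have hca : ∀ _ : Fin n, c ∈ Set.Icc 0 (Real.pi / 2) := fun _ => hc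
    have hZ0 : 0 ≤ angleSum Sᶜ (fun _ => c) / √(Sᶜ.card : ℝ) :=
      div_nonneg (angleSum_nonneg Sᶜ hca) hsm'.le
    have hZ1 : angleSum Sᶜ (fun _ => c) / √(Sᶜ.card : ℝ) ≤ 1 :=
      (div_le_one hsm').2 (angleSum_le_sqrt_card _ _)
    generalize angleSum Sᶜ (fun _ => c) / √(Sᶜ.card : ℝ) = Z at hlower hZ0 hZ1
    -- The unmarked part can only cancel the marked one when cos t < 0, and then by at most η.
    have hcZ : -η ≤ Real.cos t * Z := by
      rcases le_total 0 (Real.cos t) with h | h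
      · linarith [mul_nonneg h hZ0]
      · linarith [mul_le_mul_of_nonpos_left hZ1 h, hle.2]
    have hval : Real.sin t ^ 2 / (S.card : ℝ) * maxWeightSumSq S = (Real.sin t * A) ^ 2 := by
      rw [maxWeightSumSq_eq, hA, mul_pow, div_pow, Real.sq_sqrt hm0.le]
      ring
    rw [gme, hval]
    exact abs_one_sub_sub_le hη hη' hsA0 hsA1 hmax0 hmax1 hmax hupper (by linarith) hlower

end GroverGME

theorem theorem1 :
    ∀ ε : ℝ, 0 < ε → ∃ δ : ℝ, 0 < δ ∧
      ∀ (n : ℕ) (S : Finset (Fin n → Fin 2)), S.Nonempty →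
        (S.card : ℝ) ≤ δ * 2 ^ n →
        GroverGME.IsSymmetricState (GroverGME.markedState S) →
        ∀ k : ℕ, k ≤ GroverGME.optIter S →
          (GroverGME.thetaIter S k ≤ GroverGME.turningPoint S →
            |GroverGME.gme (GroverGME.groverState S k)
              - Real.sin (GroverGME.thetaIter S k) ^ 2| ≤ ε) ∧
          (GroverGME.turningPoint S < GroverGME.thetaIter S k →
            |GroverGME.gme (GroverGME.groverState S k)
              - (1 - Real.sin (GroverGME.thetaIter S k) ^ 2 / (S.card : ℝ)
                  * GroverGME.maxWeightSumSq S)| ≤ ε) := by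
  intro ε hε
  have hη : 0 < min 1 (ε / 6) := by positivity
  -- Both branches have error 6η, so η = min 1 (ε/6) suffices.
  refine ⟨min 1 (ε / 6) ^ 12 / 256, by positivity, fun n S hS hM hsym k hk => ?_⟩
  have hle : 6 * min 1 (ε / 6) ≤ ε := by linarith [min_le_right 1 (ε / 6)]
  obtain ⟨h1, h2⟩ :=
    GroverGME.gme_groverState_bounds hS hη (min_le_left _ _) hM hsym hk
  exact ⟨fun h => (h1 h).trans hle, fun h => (h2 h).trans hle⟩
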